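/- Let $\mathcal H$ and $\mathcal K$ be complex separable Hilbert spaces, let $\mathcal{CR}(\mathcal H,\mathcal K)$ be the set of bounded linear operators from $\mathcal H$ to $\mathcal K$ with closed range, and let $\mathcal G_{\mathcal H}$, $\mathcal G_{\mathcal K}$ be the groups of invertible bounded operators on $\mathcal H$, $\mathcal K$. For $A,B\in\mathcal{CR}(\mathcal H,\mathcal K)$ put $$d_R(A,B)=\bigl(\|P_{R(A)}-P_{R(B)}\|^2+\|A-B\|^2\bigr)^{1/2},\qquad d_N(A,B)=\bigl(\|P_{N(A)}-P_{N(B)}\|^2+\|A-B\|^2\bigr)^{1/2},$$ where $R(\cdot)$ and $N(\cdot)$ denote range and nullspace, $P_{\mathcal S}$ is the orthogonal projection onto the closed subspace $\mathcal S$, and $\|\cdot\|$ is the operator norm. These are metrics on $\mathcal{CR}(\mathcal H,\mathcal K)$. Let $A\in\mathcal{CR}(\mathcal H,\mathcal K)$ and let $$\mathcal O_A=\{GAH^{-1}: G\in\mathcal G_{\mathcal K},\ H\in\mathcal G_{\mathcal H}\}\subseteq\mathcal{CR}(\mathcal H,\mathcal K)$$ be its orbit. Then, for each of the two metrics $d_X$,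 $X\in\{R,N\}$, the connected component of $A$ in $(\mathcal{CR}(\mathcal H,\mathcal K),d_X)$ is $\mathcal O_A$. Moreover, $\mathcal O_A$ is open, closed and path connected in $(\mathcal{CR}(\mathcal H,\mathcal K),d_X)$. -/

import Mathlib

noncomputable section

namespace ClosedRange

variable (H K : Type*)
  [NormedAddCommGroup H] [InnerProductSpace ℂ H] [CompleteSpace H]
  [NormedAddCommGroup K] [InnerProductSpace ℂ K] [CompleteSpace K]

/-- The set `CR(H, K)` of bounded linear operators from `H` to `K` with closed range.
It is a structure, so it carries no topology other than those chosen explicitly below. -/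
@[ext]
structure CR where
  /-- The underlying bounded operator. -/
  op : H →L[ℂ] K
  isClosed_range : IsClosed (op.range : Set K)

variable {H K}

instance (A : CR H K) : A.op.range.HasOrthogonalProjection :=
  haveI : CompleteSpace A.op.range := A.isClosed_range.completeSpace_coe
  inferInstance

/-- The orthogonal projection `P_{R(A)}` of `K` onto the range of `A`. -/
def projRange (A : CR H K) : K →L[ℂ] K := A.op.range.starProjection

/-- The orthogonal projection `P_{N(A)}` of `H` onto the nullspace of `A`. -/
def projNull (A : CR H K) : H →L[ℂ] H := A.op.ker.starProjection

/-- `d_R(A, B) = (‖P_{R(A)} - P_{R(B)}‖² + ‖A - B‖²)^{1/2}`. -/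
def distR (A B : CR H K) : ℝ :=
  √(‖projRange A - projRange B‖ ^ 2 + ‖A.op - B.op‖ ^ 2)

/-- `d_N(A, B) = (‖P_{N(A)} - P_{N(B)}‖² + ‖A - B‖²)^{1/2}`. -/
def distN (A B : CR H K) : ℝ :=
  √(‖projNull A - projNull B‖ ^ 2 + ‖A.op - B.op‖ ^ 2)

theorem sqrt_sq_add_sq_triangle {E F : Type*} [SeminormedAddCommGroup E]
    [SeminormedAddCommGroup F] (a b c : E) (x y z : F) :
    √(‖a - c‖ ^ 2 + ‖x - z‖ ^ 2) ≤
      √(‖a - b‖ ^ 2 + ‖x - y‖ ^ 2) + √(‖b - c‖ ^ 2 + ‖y - z‖ ^ 2) := by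
  have h := dist_triangle (WithLp.toLp 2 (a, x)) (WithLp.toLp 2 (b, y)) (WithLp.toLp 2 (c, z))
  simpa [dist_eq_norm, WithLp.prod_norm_eq_of_L2] using h

set_option linter.unusedSectionVars false in
theorem op_eq_of_sqrt_eq_zero {A B : CR H K} {r : ℝ}
    (h : √(r ^ 2 + ‖A.op - B.op‖ ^ 2) = 0) : A = B := by
  rw [Real.sqrt_eq_zero (by positivity)] at h
  have h2 : ‖A.op - B.op‖ = 0 := by
    nlinarith [sq_nonneg r, sq_nonneg ‖A.op - B.op‖, norm_nonneg (A.op - B.op)]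
  exact CR.ext (sub_eq_zero.mp (norm_eq_zero.mp h2))

variable (H K)

/-- The metric space `(CR(H, K), d_R)`, with the topology given by `d_R`. -/
abbrev metricR : MetricSpace (CR H K) where
  dist := distR
  dist_self A := by simp [distR]
  dist_comm A B := by simp only [distR, norm_sub_rev]
  dist_triangle A B C := sqrt_sq_add_sq_triangle _ _ _ _ _ _
  eq_of_dist_eq_zero h := op_eq_of_sqrt_eq_zero h

/-- The metric space `(CR(H, K), d_N)`, with the topology given by `d_N`. -/
abbrev metricN : MetricSpace (CR H K) where
  dist := distN
  dist_self A := by simp [distN]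
  dist_comm A B := by simp only [distN, norm_sub_rev]
  dist_triangle A B C := sqrt_sq_add_sq_triangle _ _ _ _ _ _
  eq_of_dist_eq_zero h := op_eq_of_sqrt_eq_zero h

variable {H K}

set_option linter.unusedSectionVars false in
theorem isClosed_range_mul (g : (K →L[ℂ] K)ˣ × (H →L[ℂ] H)ˣ) (A : CR H K) :
    IsClosed (((g.1 : K →L[ℂ] K) ∘L A.op ∘L ((g.2⁻¹ : (H →L[ℂ] H)ˣ) : H →L[ℂ] H)).range
      : Set K) := by
  let e := ContinuousLinearEquiv.ofUnit g.1
  let f := ContinuousLinearEquiv.ofUnit g.2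
  have h : (((g.1 : K →L[ℂ] K) ∘L A.op ∘L ((g.2⁻¹ : (H →L[ℂ] H)ˣ) : H →L[ℂ] H)).range
      : Set K) = e '' (A.op.range : Set K) := by
    ext y
    constructor
    · rintro ⟨x, rfl⟩
      exact ⟨A.op (f.symm x), ⟨f.symm x, rfl⟩, rfl⟩
    · rintro ⟨_, ⟨x, rfl⟩, rfl⟩
      refine ⟨f x, ?_⟩
      change e (A.op (f.symm (f x))) = e (A.op x)
      rw [f.symm_apply_apply]
  rw [h]
  exact e.toHomeomorph.isClosedMap _ A.isClosed_range

/-- The action `(G, H) • A = G A H⁻¹` of the product of the groups of invertible operators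
on `K` and on `H`. -/
instance : MulAction ((K →L[ℂ] K)ˣ × (H →L[ℂ] H)ˣ) (CR H K) where
  smul g A :=
    ⟨(g.1 : K →L[ℂ] K) ∘L A.op ∘L ((g.2⁻¹ : (H →L[ℂ] H)ˣ) : H →L[ℂ] H), isClosed_range_mul g A⟩
  one_smul A := by
    apply CR.ext
    ext x
    change A.op ((((1 : (H →L[ℂ] H)ˣ)⁻¹ : (H →L[ℂ] H)ˣ) : H →L[ℂ] H) x) = A.op x
    simp
  mul_smul g h A := by
    apply CR.ext
    ext x
    change (g.1 : K →L[ℂ] K) ((h.1 : K →L[ℂ] K)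
      (A.op ((((g.2 * h.2)⁻¹ : (H →L[ℂ] H)ˣ) : H →L[ℂ] H) x))) = _
    rw [mul_inv_rev]
    rfl

/-- The orbit `O_A = {G A H⁻¹ : G, H invertible operators on K and H}`. -/
def orbit (A : CR H K) : Set (CR H K) :=
  MulAction.orbit ((K →L[ℂ] K)ˣ × (H →L[ℂ] H)ˣ) A

end ClosedRange

end

/-! Orbits partition the space, so if each point has a neighbourhood inside its own orbit, every
orbit is clopen. `connectedComponent_eq_orbit` combines this with path connectedness of the orbit,
the image of two path connected groups under a continuous action.

Neighbourhoods: when `B` is close to `A`, the intertwiner of the range projections is an invertible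
`g`, and with `J` the Moore–Penrose inverse of `A` the operator `h = J g⁻¹ B + P_{N(A)}` is near `1`
and satisfies `A h = g⁻¹ B`. For `d_N`, `h` intertwines the null projections and `g = B h J + 1 -
P_{R(A)}` satisfies `g A = B h`.

Paths: polar decomposition reduces the general linear group to positive and unitary elements. A
unitary `U` is joined to `1` by two segments through `iS`, where `S` is a symmetry commuting with
`U` such that `S * Im U ≥ 0`. -/

open Topology Filter

/-! ### Segments of invertible elements -/

section Units

variable {R : Type*} [NormedRing R]

theorem Units.joined_of_forall_isUnit [CompleteSpace R] [NormedAlgebra ℝ R] {a b : Rˣ}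
    (h : ∀ s t : ℝ, 0 ≤ s → 0 ≤ t → s + t = 1 → IsUnit (s • (a : R) + t • (b : R))) :
    Joined a b := by
  have hu : ∀ t : unitInterval, IsUnit ((1 - (t : ℝ)) • (a : R) + (t : ℝ) • (b : R)) := fun t =>
    h _ _ (sub_nonneg.2 t.2.2) t.2.1 (by ring)
  refine ⟨⟨⟨fun t => (hu t).unit, ?_⟩, ?_, ?_⟩⟩
  -- By completeness the topology on units is induced from the ring, so inverses need no separate
  -- check.
  · rw [Units.isOpenEmbedding_val.isEmbedding.continuous_iff]
    change Continuous fun t : unitInterval => (1 - (t : ℝ)) • (a : R) + (t : ℝ) • (b : R)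
    fun_prop
  · ext; simp
  · ext; simp

theorem Units.joined_one_of_mul {u p : Rˣ} (hu : Joined u 1) (hp : Joined p 1) :
    Joined (u * p) 1 := by
  simpa using hu.mul hp

end Units

/-! ### Invertibility along segments in a C⋆-algebra -/

section CStar

variable {A : Type*} [CStarAlgebra A]

theorem isUnit_smul_one_add_smul_I_smul {S : A} (hS : S * S = 1) {s t : ℝ} (h : s + t = 1) :
    IsUnit (s • (1 : A) + t • (Complex.I • S)) := by
  have hpos : s ^ 2 + t ^ 2 ≠ 0 := by nlinarith [sq_nonneg (s - t)]
  have h1 : (s • (1 : A) + t • (Complex.I • S)) * (s • (1 : A) - t • (Complex.I • S)) =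
      (s ^ 2 + t ^ 2) • (1 : A) := by
    simp only [add_mul, mul_sub, smul_mul_smul_comm, mul_one, one_mul, hS, Complex.I_mul_I]
    module
  have h2 : (s • (1 : A) - t • (Complex.I • S)) * (s • (1 : A) + t • (Complex.I • S)) =
      (s ^ 2 + t ^ 2) • (1 : A) := by
    simp only [sub_mul, mul_add, smul_mul_smul_comm, mul_one, one_mul, hS, Complex.I_mul_I]
    module
  have hc : Commute (s • (1 : A) + t • (Complex.I • S)) (s • (1 : A) - t • (Complex.I • S)) :=
    h1.trans h2.symm
  refine (hc.isUnit_mul_iff.1 ?_).1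
  rw [h1]
  simpa [Algebra.algebraMap_eq_smul_one] using (IsUnit.mk0 _ hpos).map (algebraMap ℝ A)

variable [PartialOrder A] [StarOrderedRing A]

/-- Multiplying by the adjoint `sU* - itS`, on either side, gives `s² + t² + 2st S Im U`, which is
at least a positive scalar and hence invertible. -/
theorem isUnit_smul_add_smul_I_smul {U S : A} (hU : U ∈ unitary A) (hS : S * S = 1)
    (hSs : star S = S) (hc : Commute S U) (hpos : 0 ≤ S * (imaginaryPart U : A)) {s t : ℝ}
    (hs : 0 ≤ s) (ht : 0 ≤ t) (h : s + t = 1) :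
    IsUnit (s • U + t • (Complex.I • S)) := by
  have hst : 0 < s ^ 2 + t ^ 2 := by nlinarith [sq_nonneg (s - t)]
  have hc' : Commute S (star U) := by simpa [hSs] using hc.star_star
  have hI : (imaginaryPart U : A) = -Complex.I • ((1 / 2 : ℝ) • (U - star U)) := by
    rw [imaginaryPart_apply_coe]; simp
  have hsum : (s ^ 2 + t ^ 2) • (1 : A) + (2 * (s * t)) • (S * (imaginaryPart U : A)) =
      (s ^ 2 + t ^ 2) • (1 : A) + (s * t) • (Complex.I • (S * star U - S * U)) := by
    rw [hI]
    simp only [mul_smul_comm, mul_sub]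
    module
  have h1 : (s • star U - t • (Complex.I • S)) * (s • U + t • (Complex.I • S)) =
      (s ^ 2 + t ^ 2) • (1 : A) + (2 * (s * t)) • (S * (imaginaryPart U : A)) := by
    rw [hsum]
    simp only [sub_mul, mul_add, smul_mul_assoc, mul_smul_comm, hS,
      Unitary.star_mul_self_of_mem hU, ← hc'.eq]
    match_scalars <;> simp <;> first | ring1 | linear_combination (-(t : ℂ) ^ 2) * Complex.I_sq
  have h2 : (s • U + t • (Complex.I • S)) * (s • star U - t • (Complex.I • S)) =
      (s ^ 2 + t ^ 2) • (1 : A) + (2 * (s * t)) • (S * (imaginaryPart U : A)) := by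
    rw [hsum]
    simp only [add_mul, mul_sub, smul_mul_assoc, mul_smul_comm, hS,
      Unitary.mul_star_self_of_mem hU, ← hc.eq]
    match_scalars <;> simp <;> first | ring1 | linear_combination (-(t : ℂ) ^ 2) * Complex.I_sq
  have hcomm : Commute (s • U + t • (Complex.I • S)) (s • star U - t • (Complex.I • S)) :=
    h2.trans h1.symm
  refine (hcomm.isUnit_mul_iff.1 ?_).1
  rw [h2]
  have hunit : IsStrictlyPositive ((s ^ 2 + t ^ 2) • (1 : A)) :=
    IsStrictlyPositive.smul hst isStrictlyPositive_one
  exact CStarAlgebra.isUnit_of_le _ (le_add_of_nonneg_right (smul_nonneg (by positivity) hpos))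
    hunit

/-- Polar decomposition with `p = |g|`, invertible because its square `g* g` is. -/
theorem Units.exists_eq_mul_of_unitary_of_nonneg (g : Aˣ) :
    ∃ u p : Aˣ, (u : A) ∈ unitary A ∧ (0 : A) ≤ p ∧ g = u * p := by
  have habs : IsUnit (CFC.abs (g : A)) := by
    have h : IsUnit (CFC.abs (g : A) * CFC.abs (g : A)) := by
      rw [CFC.abs_mul_abs]; exact g.isUnit.star.mul g.isUnit
    exact ((Commute.refl _).isUnit_mul_iff.1 h).1
  obtain ⟨p, hp⟩ := habs
  have hp0 : (0 : A) ≤ p := hp ▸ CFC.abs_nonneg _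
  have hps : star p = p := by ext; simpa using hp0.isSelfAdjoint.star_eq
  have hsq : p * p = star g * g := by ext; simp [hp, CFC.abs_mul_abs]
  refine ⟨g * p⁻¹, p, ?_, hp0, by simp⟩
  have h1 : star (g * p⁻¹) * (g * p⁻¹) = 1 := by
    rw [star_mul, star_inv, hps, mul_assoc, ← mul_assoc (star g), ← hsq]
    group
  have h2 : (g * p⁻¹) * star (g * p⁻¹) = 1 := mul_eq_one_comm.1 h1
  exact ⟨by simpa using congrArg Units.val h1, by simpa using congrArg Units.val h2⟩

theorem Units.joined_one_of_nonneg {p : Aˣ} (hp : (0 : A) ≤ p) : Joined p 1 := by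
  refine Units.joined_of_forall_isUnit fun s t hs ht h => ?_
  have hp' : IsStrictlyPositive (p : A) := p.isStrictlyPositive_of_le hp
  rcases hs.eq_or_lt with rfl | hs
  · obtain rfl : t = 1 := by simpa using h
    simp
  · refine CStarAlgebra.isUnit_of_le (s • (p : A)) ?_ (IsStrictlyPositive.smul hs hp')
    exact le_add_of_nonneg_right (smul_nonneg ht (by simp))

end CStar

/-! ### Path connectedness of the general linear group -/

section Hilbert

variable {H : Type*} [NormedAddCommGroup H] [InnerProductSpace ℂ H] [CompleteSpace H]

open ContinuousLinearMap

/-- The symmetry is `1 - 2 P`, where `P` is the orthogonal projection onto `ker T⁺`. -/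
theorem IsSelfAdjoint.exists_symmetry {T : H →L[ℂ] H} (hT : IsSelfAdjoint T) :
    ∃ S : H →L[ℂ] H, S * S = 1 ∧ star S = S ∧ 0 ≤ S * T ∧
      ∀ U : H →L[ℂ] H, Commute U T → Commute S U := by
  have hcl : IsClosed ((T⁺).ker : Set H) := T⁺.isClosed_ker
  have : CompleteSpace (T⁺).ker := hcl.completeSpace_coe
  set P : H →L[ℂ] H := (T⁺).ker.starProjection with hP
  have hPP : P * P = P := (isStarProjection_starProjection (U := (T⁺).ker)).isIdempotentElem
  have hPs : star P = P := (isStarProjection_starProjection (U := (T⁺).ker)).isSelfAdjoint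
  have hTs : star T⁺ = T⁺ := (CFC.posPart_nonneg T).isSelfAdjoint
  have key : ∀ X : H →L[ℂ] H, T⁺ * X = 0 → P * X = X := fun X hX => by
    ext x
    exact Submodule.starProjection_eq_self_iff.2 (DFunLike.congr_fun hX x)
  have hTP : T⁺ * P = 0 := by
    ext x
    exact (T⁺).ker.starProjection_apply_mem x
  have hPT : P * T⁺ = 0 := by simpa [hTs, hPs] using congrArg star hTP
  have hPN : P * T⁻ = T⁻ := key _ (CFC.posPart_mul_negPart T)
  -- `U` commutes with `T⁺` by functional calculus, so it preserves `ker T⁺`; the same for `star U`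
  -- will make `P` commute with `U`.
  have hcomm : ∀ U : H →L[ℂ] H, Commute U T → P * U * P = U * P := fun U hU => by
    have hUT : Commute U T⁺ := (hU.symm.cfcₙ_real _).symm
    rw [mul_assoc]
    apply key
    rw [← mul_assoc, ← hUT.eq, mul_assoc, hTP, mul_zero]
  refine ⟨1 - 2 • P, ?_, by simp only [star_sub, star_one, star_nsmul, hPs], ?_, fun U hU => ?_⟩
  · simp only [sub_mul, mul_sub, one_mul, mul_one, smul_mul_smul_comm, hPP]
    module
  · have h : (1 - 2 • P) * T = T⁺ + T⁻ := by
      nth_rw 1 [← CFC.posPart_sub_negPart T hT]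
      simp only [sub_mul, mul_sub, one_mul, smul_mul_assoc, hPN, hPT]
      module
    rw [h]
    exact add_nonneg (CFC.posPart_nonneg T) (CFC.negPart_nonneg T)
  · have h1 := hcomm U hU
    have hU' : Commute (star U) T := by simpa [hT.star_eq] using hU.star_star
    have h2 : P * U * P = P * U := by
      simpa [hPs, mul_assoc] using congrArg star (hcomm _ hU')
    have h3 : Commute P U := h2.symm.trans h1
    exact (Commute.one_left U).sub_left (Commute.smul_left h3 (2 : ℕ))

theorem ContinuousLinearMap.joined_one_of_mem_unitary {u : (H →L[ℂ] H)ˣ}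
    (hu : (u : H →L[ℂ] H) ∈ unitary (H →L[ℂ] H)) : Joined u 1 := by
  obtain ⟨S, hS, hSs, hpos, hcomm⟩ :=
    (imaginaryPart (u : H →L[ℂ] H)).2.exists_symmetry
  have hc : Commute S u := by
    refine hcomm _ ?_
    rw [imaginaryPart_apply_coe]
    refine Commute.smul_right (Commute.smul_right (Commute.sub_right (Commute.refl _) ?_) _) _
    exact (Unitary.mul_star_self_of_mem hu).trans (Unitary.star_mul_self_of_mem hu).symm
  have hunit : IsUnit (Complex.I • S) := by
    simpa using isUnit_smul_one_add_smul_I_smul hS (zero_add (1 : ℝ))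
  obtain ⟨w, hw⟩ := hunit
  refine Joined.trans (y := w) ?_ (Joined.symm ?_)
  · refine Units.joined_of_forall_isUnit fun s t hs ht h => ?_
    rw [hw]
    exact isUnit_smul_add_smul_I_smul hu hS hSs hc hpos hs ht h
  · refine Units.joined_of_forall_isUnit fun s t hs ht h => ?_
    rw [hw]
    exact isUnit_smul_one_add_smul_I_smul hS h

/-- The general linear group of a complex Hilbert space is path connected in the norm topology. -/
instance ContinuousLinearMap.pathConnectedSpace_units : PathConnectedSpace (H →L[ℂ] H)ˣ := by
  have h : ∀ g : (H →L[ℂ] H)ˣ, Joined g 1 := fun g => by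
    obtain ⟨u, p, hu, hp, rfl⟩ := g.exists_eq_mul_of_unitary_of_nonneg
    exact Units.joined_one_of_mul (joined_one_of_mem_unitary hu) (Units.joined_one_of_nonneg hp)
  exact ⟨⟨1⟩, fun a b => (h a).trans (h b).symm⟩

end Hilbert


/-! ### Comparing orthogonal and oblique projections -/

section Projections

variable {E : Type*} [NormedAddCommGroup E] [InnerProductSpace ℂ E]

namespace Submodule

variable (M N : Submodule ℂ E) [M.HasOrthogonalProjection] [N.HasOrthogonalProjection]

theorem norm_one_sub_starProjection_le : ‖1 - M.starProjection‖ ≤ 1 := by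
  have h : (1 : E →L[ℂ] E) - M.starProjection = Mᗮ.starProjection := by
    ext x; simp
  exact h ▸ Mᗮ.starProjection_norm_le

variable {M N} in
-- Inserting `p - q` between the factors changes nothing: `p` is the identity on `M`, and `1 - P_N`
-- kills the range of `q`.
theorem norm_one_sub_starProjection_mul_le {p q : E →L[ℂ] E} (hpM : ∀ x ∈ M, p x = x)
    (hq : ∀ x, q x ∈ N) : ‖(1 - N.starProjection) * M.starProjection‖ ≤ ‖p - q‖ := by
  have h : (1 - N.starProjection) * M.starProjection =
      (1 - N.starProjection) * (p - q) * M.starProjection := by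
    ext x
    have h1 := hpM _ (M.starProjection_apply_mem x)
    have h2 := starProjection_eq_self_iff.2 (hq (M.starProjection x))
    simp [h1, h2]
  rw [h]
  calc _ ≤ ‖1 - N.starProjection‖ * ‖p - q‖ * ‖M.starProjection‖ := by
        grw [norm_mul_le, norm_mul_le]
    _ ≤ 1 * ‖p - q‖ * 1 := by
        grw [norm_one_sub_starProjection_le, starProjection_norm_le]
    _ = _ := by ring

variable [CompleteSpace E]

theorem starProjection_mul_self : M.starProjection * M.starProjection = M.starProjection :=
  (isStarProjection_starProjection (U := M)).isIdempotentElem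

theorem star_starProjection : star M.starProjection = M.starProjection :=
  (isStarProjection_starProjection (U := M)).isSelfAdjoint

variable {M N}

/-- Orthogonal projections depend on (not necessarily orthogonal) projections with the same range
in a Lipschitz way. -/
theorem norm_starProjection_sub_le {p q : E →L[ℂ] E} (hp : ∀ x, p x ∈ M) (hpM : ∀ x ∈ M, p x = x)
    (hq : ∀ x, q x ∈ N) (hqN : ∀ x ∈ N, q x = x) :
    ‖M.starProjection - N.starProjection‖ ≤ 2 * ‖p - q‖ := by
  have h : M.starProjection - N.starProjection = (1 - N.starProjection) * M.starProjection -
      star ((1 - M.starProjection) * N.starProjection) := by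
    simp only [star_mul, star_sub, star_one, star_starProjection]
    noncomm_ring
  rw [h]
  grw [norm_sub_le, norm_star, norm_one_sub_starProjection_mul_le hpM hq,
    norm_one_sub_starProjection_mul_le hqN hp, norm_sub_rev q p]
  linarith

variable (M N)

/-- An operator intertwining the projections onto `M` and `N`, which is invertible when these are
close to each other. -/
noncomputable def intertwiner : E →L[ℂ] E :=
  N.starProjection * M.starProjection + (1 - N.starProjection) * (1 - M.starProjection)

theorem intertwiner_self : intertwiner M M = 1 := by
  simp only [intertwiner, mul_sub, sub_mul, starProjection_mul_self]
  noncomm_ring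

theorem intertwiner_mul_starProjection :
    intertwiner M N * M.starProjection = N.starProjection * intertwiner M N := by
  have hM := M.starProjection_mul_self
  have hN := N.starProjection_mul_self
  simp only [intertwiner, mul_sub, sub_mul, mul_add, add_mul, mul_one, one_mul, mul_assoc, hM]
  simp only [← mul_assoc, hN]
  noncomm_ring

end Submodule

end Projections

/-! ### The Moore–Penrose inverse -/

section PseudoInverse

variable {H K : Type*}
  [NormedAddCommGroup H] [InnerProductSpace ℂ H] [CompleteSpace H]
  [NormedAddCommGroup K] [InnerProductSpace ℂ K]

/-- Existence of the Moore–Penrose inverse of an operator with closed range. -/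
theorem ContinuousLinearMap.exists_pseudoInverse (A : H →L[ℂ] K)
    [CompleteSpace A.range] :
    ∃ J : K →L[ℂ] H, A ∘L J = A.range.starProjection ∧ J ∘L A = 1 - A.ker.starProjection := by
  let f : A.kerᗮ →L[ℂ] A.range :=
    (A ∘L A.kerᗮ.subtypeL).codRestrict A.range fun x => ⟨x, rfl⟩
  have hA : ∀ x, A (x - A.ker.starProjection x) = A x := fun x => by
    rw [map_sub, sub_eq_self]
    exact A.ker.starProjection_apply_mem x
  have hmem : ∀ x, x - A.ker.starProjection x ∈ A.kerᗮ := fun x =>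
    A.ker.sub_starProjection_mem_orthogonal x
  have hinj : f.ker = ⊥ := by
    rw [LinearMap.ker_eq_bot']
    intro x hx
    have h1 : (x : H) ∈ A.ker := congrArg Subtype.val hx
    exact Subtype.ext (inner_self_eq_zero.1 (x.2 _ h1))
  have hsurj : f.range = ⊤ := by
    rw [LinearMap.range_eq_top]
    rintro ⟨_, x, rfl⟩
    exact ⟨⟨_, hmem x⟩, Subtype.ext (hA x)⟩
  -- The open mapping theorem applies because the range is complete.
  let e := ContinuousLinearEquiv.ofBijective f hinj hsurj
  have he : ∀ y, e y = f y := fun _ => rfl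
  refine ⟨A.kerᗮ.subtypeL ∘L (e.symm : A.range →L[ℂ] A.kerᗮ) ∘L
    A.range.orthogonalProjectionOnto, ?_, ?_⟩
  · ext y
    exact congrArg Subtype.val (e.apply_symm_apply (A.range.orthogonalProjectionOnto y))
  · ext x
    have h : A.range.orthogonalProjectionOnto (A x) = e ⟨_, hmem x⟩ := by
      refine Subtype.ext ?_
      exact (Submodule.starProjection_eq_self_iff.2 (LinearMap.mem_range_self _ x)).trans (hA x).symm
    simp [h]

end PseudoInverse


theorem Filter.Tendsto.clm_comp {ι E F G : Type*} [NormedAddCommGroup E] [NormedSpace ℂ E]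
    [NormedAddCommGroup F] [NormedSpace ℂ F] [NormedAddCommGroup G] [NormedSpace ℂ G]
    {l : Filter ι} {f : ι → F →L[ℂ] G} {g : ι → E →L[ℂ] F} {f₀ : F →L[ℂ] G} {g₀ : E →L[ℂ] F}
    (hf : Tendsto f l (𝓝 f₀)) (hg : Tendsto g l (𝓝 g₀)) :
    Tendsto (fun i => f i ∘L g i) l (𝓝 (f₀ ∘L g₀)) :=
  (isBoundedBilinearMap_comp.continuous.tendsto (f₀, g₀)).comp (hf.prodMk_nhds hg)

/-! ### Nearby operators lie in the same orbit -/

namespace ClosedRange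

variable {H K : Type*}
  [NormedAddCommGroup H] [InnerProductSpace ℂ H] [CompleteSpace H]
  [NormedAddCommGroup K] [InnerProductSpace ℂ K] [CompleteSpace K]

theorem mem_orbit_of_comp_eq {A B : CR H K} {g : K →L[ℂ] K} {h : H →L[ℂ] H} (hg : IsUnit g)
    (hh : IsUnit h) (hAB : g ∘L A.op = B.op ∘L h) : B ∈ orbit A := by
  obtain ⟨g, rfl⟩ := hg
  obtain ⟨h, rfl⟩ := hh
  refine ⟨(g, h), CR.ext ?_⟩
  change (g : K →L[ℂ] K) ∘L A.op ∘L ((h⁻¹ : (H →L[ℂ] H)ˣ) : H →L[ℂ] H) = B.op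
  rw [← ContinuousLinearMap.comp_assoc, hAB, ContinuousLinearMap.comp_assoc]
  change B.op ∘L ((h : H →L[ℂ] H) * ((h⁻¹ : (H →L[ℂ] H)ˣ) : H →L[ℂ] H)) = B.op
  rw [Units.mul_inv]
  rfl

theorem op_smul (g : (K →L[ℂ] K)ˣ × (H →L[ℂ] H)ˣ) (A : CR H K) :
    (g • A).op = (g.1 : K →L[ℂ] K) ∘L A.op ∘L ((g.2⁻¹ : (H →L[ℂ] H)ˣ) : H →L[ℂ] H) := rfl

theorem op_smul_apply (g : (K →L[ℂ] K)ˣ × (H →L[ℂ] H)ˣ) (A : CR H K) (x : H) :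
    (g • A).op x = (g.1 : K →L[ℂ] K) (A.op (((g.2⁻¹ : (H →L[ℂ] H)ˣ) : H →L[ℂ] H) x)) := rfl

theorem exists_pseudoInverse (A : CR H K) :
    ∃ J : K →L[ℂ] H, A.op ∘L J = projRange A ∧ J ∘L A.op = 1 - projNull A :=
  have : CompleteSpace A.op.range := A.isClosed_range.completeSpace_coe
  A.op.exists_pseudoInverse

set_option linter.unusedSectionVars false in
theorem op_comp_projNull (A : CR H K) : A.op ∘L projNull A = 0 := by
  ext x
  exact A.op.ker.starProjection_apply_mem x

set_option linter.unusedSectionVars false in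
theorem projRange_comp_op (A : CR H K) : projRange A ∘L A.op = A.op := by
  ext x
  exact Submodule.starProjection_eq_self_iff.2 (LinearMap.mem_range_self _ x)

theorem mem_orbit_of_projRange_intertwined {A B : CR H K} {J : K →L[ℂ] H}
    (hJ : A.op ∘L J = projRange A) {g : K →L[ℂ] K} (hg : IsUnit g)
    (hgAB : g * projRange A = projRange B * g)
    (hh : IsUnit (J ∘L Ring.inverse g ∘L B.op + projNull A)) : B ∈ orbit A := by
  have hinv : projRange A * Ring.inverse g = Ring.inverse g * projRange B := by
    calc _ = Ring.inverse g * (g * projRange A) * Ring.inverse g := by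
          rw [← mul_assoc, Ring.inverse_mul_cancel _ hg, one_mul]
      _ = Ring.inverse g * projRange B := by
          rw [hgAB, mul_assoc, mul_assoc, Ring.mul_inverse_cancel _ hg, mul_one]
  have hA : A.op ∘L (J ∘L Ring.inverse g ∘L B.op + projNull A) = Ring.inverse g ∘L B.op := by
    rw [ContinuousLinearMap.comp_add, op_comp_projNull, add_zero,
      ← ContinuousLinearMap.comp_assoc, hJ, ← ContinuousLinearMap.comp_assoc]
    change (projRange A * Ring.inverse g) ∘L B.op = _
    rw [hinv]
    change Ring.inverse g ∘L (projRange B ∘L B.op) = _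
    rw [projRange_comp_op]
  have hmem : A ∈ orbit B := mem_orbit_of_comp_eq hg.ringInverse hh hA.symm
  exact MulAction.mem_orbit_symm.1 hmem

theorem mem_orbit_of_projNull_intertwined {A B : CR H K} {J : K →L[ℂ] H}
    (hJ : J ∘L A.op = 1 - projNull A) {h : H →L[ℂ] H} (hh : IsUnit h)
    (hAB : h * projNull A = projNull B * h)
    (hg : IsUnit (B.op ∘L h ∘L J + (1 - projRange A))) : B ∈ orbit A := by
  refine mem_orbit_of_comp_eq hg hh ?_
  have h0 : B.op ∘L h ∘L projNull A = 0 := by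
    change B.op ∘L (h * projNull A) = 0
    rw [hAB]
    change (B.op ∘L projNull B) ∘L h = 0
    rw [op_comp_projNull, ContinuousLinearMap.zero_comp]
  have h1 : (1 - projRange A) ∘L A.op = 0 := by
    rw [ContinuousLinearMap.sub_comp, projRange_comp_op]
    exact sub_self _
  rw [ContinuousLinearMap.add_comp, h1, add_zero, ContinuousLinearMap.comp_assoc,
    ContinuousLinearMap.comp_assoc, hJ, ContinuousLinearMap.comp_sub, ContinuousLinearMap.comp_sub,
    h0, sub_zero]
  rfl

theorem eventually_isUnit_of_tendsto_one {R ι : Type*} [NormedRing R] [CompleteSpace R]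
    {l : Filter ι} {f : ι → R} (hf : Tendsto f l (𝓝 1)) : ∀ᶠ i in l, IsUnit (f i) :=
  hf.eventually (Units.isOpen.mem_nhds isUnit_one)

theorem tendsto_ringInverse_one {R ι : Type*} [NormedRing R] [CompleteSpace R]
    {l : Filter ι} {f : ι → R} (hf : Tendsto f l (𝓝 1)) :
    Tendsto (fun i => Ring.inverse (f i)) l (𝓝 1) := by
  have h := (NormedRing.inverse_continuousAt (1 : Rˣ)).tendsto.comp (by simpa using hf)
  simpa [Function.comp_def] using h

theorem eventually_mem_orbit_of_tendsto_projRange {A : CR H K} {l : Filter (CR H K)}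
    (hop : Tendsto CR.op l (𝓝 A.op)) (hpr : Tendsto projRange l (𝓝 (projRange A))) :
    ∀ᶠ B in l, B ∈ orbit A := by
  obtain ⟨J, hAJ, hJA⟩ := exists_pseudoInverse A
  let g : CR H K → K →L[ℂ] K := fun B => Submodule.intertwiner A.op.range B.op.range
  have hg : Tendsto g l (𝓝 1) := by
    rw [← Submodule.intertwiner_self A.op.range]
    exact (hpr.mul tendsto_const_nhds).add ((hpr.const_sub 1).mul tendsto_const_nhds)
  have hh : Tendsto (fun B => J ∘L Ring.inverse (g B) ∘L B.op + projNull A) l (𝓝 1) := by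
    have h1 : J ∘L (1 : K →L[ℂ] K) ∘L A.op + projNull A = 1 := by
      change J ∘L A.op + projNull A = 1
      rw [hJA, sub_add_cancel]
    rw [← h1]
    exact (tendsto_const_nhds.clm_comp ((tendsto_ringInverse_one hg).clm_comp hop)).add_const _
  filter_upwards [eventually_isUnit_of_tendsto_one hg, eventually_isUnit_of_tendsto_one hh]
    with B hgB hhB
  exact mem_orbit_of_projRange_intertwined hAJ hgB
    (Submodule.intertwiner_mul_starProjection _ _) hhB

theorem eventually_mem_orbit_of_tendsto_projNull {A : CR H K} {l : Filter (CR H K)}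
    (hop : Tendsto CR.op l (𝓝 A.op)) (hpr : Tendsto projNull l (𝓝 (projNull A))) :
    ∀ᶠ B in l, B ∈ orbit A := by
  obtain ⟨J, hAJ, hJA⟩ := exists_pseudoInverse A
  let h : CR H K → H →L[ℂ] H := fun B => Submodule.intertwiner A.op.ker B.op.ker
  have hh : Tendsto h l (𝓝 1) := by
    rw [← Submodule.intertwiner_self A.op.ker]
    exact (hpr.mul tendsto_const_nhds).add ((hpr.const_sub 1).mul tendsto_const_nhds)
  have hg : Tendsto (fun B : CR H K => B.op ∘L h B ∘L J + (1 - projRange A)) l (𝓝 1) := by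
    have h1 : A.op ∘L (1 : H →L[ℂ] H) ∘L J + (1 - projRange A) = 1 := by
      change A.op ∘L J + (1 - projRange A) = 1
      rw [hAJ, add_sub_cancel]
    have h2 := (hop.clm_comp (hh.clm_comp (tendsto_const_nhds (x := J)))).add_const
      (1 - projRange A)
    rwa [h1] at h2
  filter_upwards [eventually_isUnit_of_tendsto_one hg, eventually_isUnit_of_tendsto_one hh]
    with B hgB hhB
  exact mem_orbit_of_projNull_intertwined hJA hhB
    (Submodule.intertwiner_mul_starProjection _ _) hgB

/-! ### Continuity of the action -/

theorem continuous_op_smul (A : CR H K) :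
    Continuous fun g : (K →L[ℂ] K)ˣ × (H →L[ℂ] H)ˣ => (g • A).op := by
  have h1 : Continuous fun g : (K →L[ℂ] K)ˣ × (H →L[ℂ] H)ˣ => (g.1 : K →L[ℂ] K) :=
    Units.continuous_val.comp continuous_fst
  have h2 : Continuous fun g : (K →L[ℂ] K)ˣ × (H →L[ℂ] H)ˣ =>
      ((g.2⁻¹ : (H →L[ℂ] H)ˣ) : H →L[ℂ] H) :=
    Units.continuous_val.comp continuous_snd.inv
  exact h1.clm_comp (continuous_const.clm_comp h2)

theorem continuous_of_norm_sub_le {X E F : Type*} [TopologicalSpace X] [SeminormedAddCommGroup E]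
    [SeminormedAddCommGroup F] {f : X → E} {e : X → F} (he : Continuous e) {C : ℝ}
    (h : ∀ x y, ‖f x - f y‖ ≤ C * ‖e x - e y‖) : Continuous f := by
  rw [continuous_iff_continuousAt]
  intro x
  rw [ContinuousAt, tendsto_iff_norm_sub_tendsto_zero]
  refine squeeze_zero (fun _ => norm_nonneg _) (fun y => h y x) ?_
  simpa using (tendsto_iff_norm_sub_tendsto_zero.1 (he.tendsto x)).const_mul C

theorem units_mul_inv_apply {E : Type*} [NormedAddCommGroup E] [NormedSpace ℂ E]
    (u : (E →L[ℂ] E)ˣ) (x : E) :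
    (u : E →L[ℂ] E) (((u⁻¹ : (E →L[ℂ] E)ˣ) : E →L[ℂ] E) x) = x :=
  DFunLike.congr_fun u.mul_inv x

theorem units_inv_mul_apply {E : Type*} [NormedAddCommGroup E] [NormedSpace ℂ E]
    (u : (E →L[ℂ] E)ˣ) (x : E) :
    ((u⁻¹ : (E →L[ℂ] E)ˣ) : E →L[ℂ] E) ((u : E →L[ℂ] E) x) = x :=
  DFunLike.congr_fun u.inv_mul x

theorem continuous_conj_units {E : Type*} [NormedAddCommGroup E] [NormedSpace ℂ E]
    (p : E →L[ℂ] E) :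
    Continuous fun u : (E →L[ℂ] E)ˣ =>
      (u : E →L[ℂ] E) * p * ((u⁻¹ : (E →L[ℂ] E)ˣ) : E →L[ℂ] E) :=
  (Units.continuous_val.mul continuous_const).mul (Units.continuous_val.comp continuous_inv)

/-- Conjugating `P_{R(A)}` by `g.1` gives an oblique projection onto the new range, continuous in
`g`; the orthogonal one is Lipschitz in it. -/
theorem continuous_projRange_smul (A : CR H K) :
    Continuous fun g : (K →L[ℂ] K)ˣ × (H →L[ℂ] H)ˣ => projRange (g • A) := by
  have hmem : ∀ (g : (K →L[ℂ] K)ˣ × (H →L[ℂ] H)ˣ) (x : K),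
      ((g.1 : K →L[ℂ] K) * projRange A * ((g.1⁻¹ : (K →L[ℂ] K)ˣ) : K →L[ℂ] K)) x ∈
        (g • A).op.range := fun g x => by
    obtain ⟨z, hz⟩ := A.op.range.starProjection_apply_mem (((g.1⁻¹ : (K →L[ℂ] K)ˣ) : K →L[ℂ] K) x)
    refine ⟨(g.2 : H →L[ℂ] H) z, ?_⟩
    change (g • A).op _ = (g.1 : K →L[ℂ] K) (projRange A _)
    rw [op_smul_apply, units_inv_mul_apply]
    exact congrArg _ hz
  have hfix : ∀ (g : (K →L[ℂ] K)ˣ × (H →L[ℂ] H)ˣ), ∀ x ∈ (g • A).op.range,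
      ((g.1 : K →L[ℂ] K) * projRange A * ((g.1⁻¹ : (K →L[ℂ] K)ˣ) : K →L[ℂ] K)) x = x := by
    rintro g _ ⟨z, rfl⟩
    change (g.1 : K →L[ℂ] K) (projRange A (((g.1⁻¹ : (K →L[ℂ] K)ˣ) : K →L[ℂ] K)
      ((g.1 : K →L[ℂ] K) _))) = (g.1 : K →L[ℂ] K) _
    rw [units_inv_mul_apply]
    exact congrArg _ (DFunLike.congr_fun (projRange_comp_op A) _)
  exact continuous_of_norm_sub_le ((continuous_conj_units (projRange A)).comp continuous_fst)
    fun g h => Submodule.norm_starProjection_sub_le (hmem g) (hfix g) (hmem h) (hfix h)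

theorem continuous_projNull_smul (A : CR H K) :
    Continuous fun g : (K →L[ℂ] K)ˣ × (H →L[ℂ] H)ˣ => projNull (g • A) := by
  have hmem : ∀ (g : (K →L[ℂ] K)ˣ × (H →L[ℂ] H)ˣ) (x : H),
      ((g.2 : H →L[ℂ] H) * projNull A * ((g.2⁻¹ : (H →L[ℂ] H)ˣ) : H →L[ℂ] H)) x ∈
        (g • A).op.ker := fun g x => by
    change (g.1 : K →L[ℂ] K) (A.op (((g.2⁻¹ : (H →L[ℂ] H)ˣ) : H →L[ℂ] H)
      ((g.2 : H →L[ℂ] H) (projNull A _)))) = 0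
    rw [units_inv_mul_apply]
    exact (congrArg _ (DFunLike.congr_fun (op_comp_projNull A) _)).trans (map_zero _)
  have hfix : ∀ (g : (K →L[ℂ] K)ˣ × (H →L[ℂ] H)ˣ), ∀ x ∈ (g • A).op.ker,
      ((g.2 : H →L[ℂ] H) * projNull A * ((g.2⁻¹ : (H →L[ℂ] H)ˣ) : H →L[ℂ] H)) x = x := by
    intro g x hx
    have hx' : ((g.2⁻¹ : (H →L[ℂ] H)ˣ) : H →L[ℂ] H) x ∈ A.op.ker := by
      have h := congrArg ((g.1⁻¹ : (K →L[ℂ] K)ˣ) : K →L[ℂ] K)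
        (show (g.1 : K →L[ℂ] K) (A.op (((g.2⁻¹ : (H →L[ℂ] H)ˣ) : H →L[ℂ] H) x)) = 0 from hx)
      rwa [units_inv_mul_apply, map_zero] at h
    change (g.2 : H →L[ℂ] H) (A.op.ker.starProjection _) = x
    exact (congrArg _ (Submodule.starProjection_eq_self_iff.2 hx')).trans (units_mul_inv_apply _ _)
  exact continuous_of_norm_sub_le ((continuous_conj_units (projNull A)).comp continuous_snd)
    fun g h => Submodule.norm_starProjection_sub_le (hmem g) (hfix g) (hmem h) (hfix h)

/-! ### Orbits as connected components -/

theorem connectedComponent_eq_orbit [TopologicalSpace (CR H K)]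
    (hnhds : ∀ B : CR H K, ∀ᶠ C in 𝓝 B, C ∈ orbit B)
    (hcont : ∀ B : CR H K, Continuous fun g : (K →L[ℂ] K)ˣ × (H →L[ℂ] H)ˣ => g • B)
    (A : CR H K) :
    connectedComponent A = orbit A ∧ IsOpen (orbit A) ∧ IsClosed (orbit A) ∧
      IsPathConnected (orbit A) := by
  have hopen : IsOpen (orbit A) := isOpen_iff_mem_nhds.2 fun B hB => by
    have h : orbit B = orbit A := MulAction.orbit_eq_iff.2 hB
    exact h ▸ hnhds B
  have hclosed : IsClosed (orbit A) := by
    refine isOpen_compl_iff.1 (isOpen_iff_mem_nhds.2 fun B hB => ?_)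
    filter_upwards [hnhds B] with C hC hCA
    exact hB (MulAction.orbit_eq_iff.1
      ((MulAction.orbit_eq_iff.2 hC).symm.trans (MulAction.orbit_eq_iff.2 hCA)))
  have hpath : IsPathConnected (orbit A) := isPathConnected_range (hcont A)
  have hself : A ∈ orbit A := MulAction.mem_orbit_self A
  exact ⟨(IsClopen.connectedComponent_subset ⟨hclosed, hopen⟩ hself).antisymm
    (hpath.isConnected.isPreconnected.subset_connectedComponent hself), hopen, hclosed, hpath⟩

theorem tendsto_sqrt_norm_sq_add_norm_sq {ι E F : Type*} [SeminormedAddCommGroup E]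
    [SeminormedAddCommGroup F] {l : Filter ι} {e : ι → E} {f : ι → F} {e₀ : E} {f₀ : F} :
    Tendsto (fun i => √(‖e i - e₀‖ ^ 2 + ‖f i - f₀‖ ^ 2)) l (𝓝 0) ↔
      Tendsto e l (𝓝 e₀) ∧ Tendsto f l (𝓝 f₀) := by
  rw [tendsto_iff_norm_sub_tendsto_zero (f := e), tendsto_iff_norm_sub_tendsto_zero (f := f)]
  constructor
  · intro h
    constructor
    · exact squeeze_zero (fun _ => norm_nonneg _)
        (fun i => Real.le_sqrt_of_sq_le (le_add_of_nonneg_right (sq_nonneg _))) h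
    · exact squeeze_zero (fun _ => norm_nonneg _)
        (fun i => Real.le_sqrt_of_sq_le (le_add_of_nonneg_left (sq_nonneg _))) h
  · rintro ⟨h1, h2⟩
    simpa using ((h1.pow 2).add (h2.pow 2)).sqrt

theorem tendsto_metricR_iff {ι : Type*} {l : Filter ι} {f : ι → CR H K} {A : CR H K} :
    (letI : MetricSpace (CR H K) := metricR H K
     Tendsto f l (𝓝 A)) ↔ Tendsto (fun i => projRange (f i)) l (𝓝 (projRange A)) ∧
      Tendsto (fun i => (f i).op) l (𝓝 A.op) := by
  let _ : MetricSpace (CR H K) := metricR H K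
  exact tendsto_iff_dist_tendsto_zero.trans tendsto_sqrt_norm_sq_add_norm_sq

theorem tendsto_metricN_iff {ι : Type*} {l : Filter ι} {f : ι → CR H K} {A : CR H K} :
    (letI : MetricSpace (CR H K) := metricN H K
     Tendsto f l (𝓝 A)) ↔ Tendsto (fun i => projNull (f i)) l (𝓝 (projNull A)) ∧
      Tendsto (fun i => (f i).op) l (𝓝 A.op) := by
  let _ : MetricSpace (CR H K) := metricN H K
  exact tendsto_iff_dist_tendsto_zero.trans tendsto_sqrt_norm_sq_add_norm_sq

end ClosedRange

theorem corollary5p9 {H K : Type*}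
    [NormedAddCommGroup H] [InnerProductSpace ℂ H] [CompleteSpace H]
    [TopologicalSpace.SeparableSpace H]
    [NormedAddCommGroup K] [InnerProductSpace ℂ K] [CompleteSpace K]
    [TopologicalSpace.SeparableSpace K]
    (A : ClosedRange.CR H K) :
    (letI : MetricSpace (ClosedRange.CR H K) := ClosedRange.metricR H K
     connectedComponent A = ClosedRange.orbit A ∧
       IsOpen (ClosedRange.orbit A) ∧ IsClosed (ClosedRange.orbit A) ∧
       IsPathConnected (ClosedRange.orbit A)) ∧
    (letI : MetricSpace (ClosedRange.CR H K) := ClosedRange.metricN H K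
     connectedComponent A = ClosedRange.orbit A ∧
       IsOpen (ClosedRange.orbit A) ∧ IsClosed (ClosedRange.orbit A) ∧
       IsPathConnected (ClosedRange.orbit A)) := by
  constructor
  · let _ : MetricSpace (ClosedRange.CR H K) := ClosedRange.metricR H K
    refine ClosedRange.connectedComponent_eq_orbit (fun B => ?_) (fun B => ?_) A
    · obtain ⟨h1, h2⟩ := ClosedRange.tendsto_metricR_iff.1 (tendsto_id (x := 𝓝 B))
      exact ClosedRange.eventually_mem_orbit_of_tendsto_projRange h2 h1
    · exact continuous_iff_continuousAt.2 fun g => ClosedRange.tendsto_metricR_iff.2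
        ⟨(ClosedRange.continuous_projRange_smul B).tendsto g,
          (ClosedRange.continuous_op_smul B).tendsto g⟩
  · let _ : MetricSpace (ClosedRange.CR H K) := ClosedRange.metricN H K
    refine ClosedRange.connectedComponent_eq_orbit (fun B => ?_) (fun B => ?_) A
    · obtain ⟨h1, h2⟩ := ClosedRange.tendsto_metricN_iff.1 (tendsto_id (x := 𝓝 B))
      exact ClosedRange.eventually_mem_orbit_of_tendsto_projNull h2 h1
    · exact continuous_iff_continuousAt.2 fun g => ClosedRange.tendsto_metricN_iff.2
        ⟨(ClosedRange.continuous_projNull_smul B).tendsto g,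
          (ClosedRange.continuous_op_smul B).tendsto g⟩
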